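/- Let $(M,g)$ be a smooth Riemannian manifold of dimension $n$, $p\in M$, and let $E\to M$ be a smooth vector bundle of rank $k$ with a smooth connection. Fix an orthonormal basis $e_1(p),\dots,e_n(p)$ of $T_pM$, normal geodesic coordinates $(x^1,\dots,x^n)\mapsto \exp_p\bigl(\sum_i x^ie_i(p)\bigr)$ on a geodesic neighbourhood $U_p$ of $p$, and a basis $s_1(p),\dots,s_k(p)$ of $E_p$. Let $(e_l)$ and $(s_j)$ be the smooth local frames of $TM$ and $E$ over $U_p$ obtained by parallel transport (for the Levi-Civita connection, resp. the connection of $E$) along the geodesics $t\mapsto\exp_p(t\mathbf x)$. The vielbeins are the functions $a_i^l$, $b_l^j$ on $U_p$ defined by $\frac{\partial}{\partial x^i}=\sum_l a_i^l e_l$ and $e_l=\sum_j b_l^j\frac{\partial}{\partial x^j}$, and $D^\gamma$ denotes partial derivatives in the coordinates $x^i$. A function on $U_p$ is a geometric polynomial of Gilkey order $d$ if it is a linear combination, with constant coefficients, of finite products $\prod_q D^{\beta_q}(a_{i_q}^{l_q})\prod_r D^{\gamma_r}(b_{l_r}^{j_r})$ with $\sum_q|\beta_q|+\sum_r|\gamma_r|=d$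 (the zero function is one of every order). A differential operator $P$ on the smooth sections of $E$, written as $P\bigl(\sum_j\alpha_js_j\bigr)=\sum_{|\gamma|\le m}\sum_{i,j}(P_\gamma)_{ij}\,D^\gamma(\alpha_j)\,s_i$ over $U_p$, is called geometric of order $m$ with respect to $g$ if for all $|\gamma|\le m$ all the entries $(P_\gamma)_{ij}$ are geometric polynomials of Gilkey order $\mathrm{ord}^{\mathrm{Gi}}(P_\gamma)=m-|\gamma|$. Here the order $m$ is understood in the filtered sense: only derivatives of order at most $m$ occur, while the coefficients of order $m$ may vanish. Proposition. If $P$ and $Q$ are differential operators on the sections of $E$ that are geometric with respect to $g$, of orders $m$ and $m'$, then the composition $PQ$ is a differential operator that is geometric with respect to $g$, of order $m+m'$; that is, $PQ=\sum_{|\gamma|\le m+m'}(PQ)_\gamma D^\gamma$ over $U_p$, with geometric polynomials $(PQ)_\gamma$ such that $\mathrm{ord}^{\mathrm{Gi}}((PQ)_\gamma)=m+m'-|\gamma|$. -/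

import Mathlib

open Bundle Manifold
open scoped ContDiff

noncomputable section

/-! ### Multi-indices and partial derivatives in `ℝⁿ` -/

/-- The partial derivative `∂f/∂xⁱ` of a function on `ℝⁿ`. -/
def partialDeriv {n : ℕ} (i : Fin n) (f : EuclideanSpace ℝ (Fin n) → ℝ) :
    EuclideanSpace ℝ (Fin n) → ℝ :=
  fun x => fderiv ℝ f x (EuclideanSpace.single i 1)

/-- The order `|γ| = γ₁ + ⋯ + γₙ` of a multi-index. -/
def multiOrder {n : ℕ} (γ : Fin n → ℕ) : ℕ := ∑ i, γ i

/-- `D^γ = (∂/∂x¹)^{γ₁} ⋯ (∂/∂xⁿ)^{γₙ}`. -/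
def multiDeriv {n : ℕ} (γ : Fin n → ℕ) (f : EuclideanSpace ℝ (Fin n) → ℝ) :
    EuclideanSpace ℝ (Fin n) → ℝ :=
  (List.finRange n).foldr (fun i h => (partialDeriv i)^[γ i] h) f

/-- The finite set of multi-indices `γ` with `|γ| ≤ m`. -/
def multiIndices (n m : ℕ) : Finset (Fin n → ℕ) :=
  (Fintype.piFinset fun _ => Finset.range (m + 1)).filter fun γ => multiOrder γ ≤ m

/-! ### Parallel transport, geodesics, the Levi-Civita connection -/

section Connections

variable {n : ℕ} {M : Type*} [TopologicalSpace M] [ChartedSpace (EuclideanSpace ℝ (Fin n)) M]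
  [IsManifold (𝓡 n) ∞ M]
  {F : Type*} [NormedAddCommGroup F] [NormedSpace ℝ F]
  {E : M → Type*} [TopologicalSpace (TotalSpace F E)]
  [∀ x, AddCommGroup (E x)] [∀ x, Module ℝ (E x)] [∀ x, TopologicalSpace (E x)]
  [∀ x, IsTopologicalAddGroup (E x)] [∀ x, ContinuousSMul ℝ (E x)]
  [FiberBundle F E] [VectorBundle ℝ F E]

/-- The velocity `c'(t)` of a curve `c` in `M`. -/
def velocity (c : ℝ → M) (t : ℝ) : TangentSpace (𝓡 n) (c t) :=
  mfderiv 𝓘(ℝ, ℝ) (𝓡 n) c t (1 : ℝ)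

/-- The covariant derivative `(∇u/dt)(t)` at time `t` of a section `u` along a curve `c`. In a
trivialization of `E` around `c t`, with `u = ∑ⱼ uʲ σⱼ` for the constant frame `σⱼ`, it equals
`∑ⱼ (uʲ)'(t) σⱼ + ∑ⱼ uʲ(t) ∇_{c'(t)} σⱼ`; the second sum is the covariant derivative of the
section which is constant in the trivialization, with value `u t` at `c t`. -/
def covDerivAlong (nabla : CovariantDerivative (𝓡 n) F E) (c : ℝ → M) (u : ∀ t, E (c t)) (t : ℝ) :
    E (c t) :=
  let e := trivializationAt F E (c t)
  e.symm (c t) (deriv (fun τ => (e ⟨c τ, u τ⟩).2) t)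
    + nabla (fun y => e.symm y (e ⟨c t, u t⟩).2) (c t) (velocity (n := n) c t)

/-- `u` is a smooth parallel section along the curve `c` over the time domain `J`. -/
def IsParallelAlong (nabla : CovariantDerivative (𝓡 n) F E) (c : ℝ → M) (u : ∀ t, E (c t))
    (J : Set ℝ) : Prop :=
  ContMDiffOn 𝓘(ℝ, ℝ) ((𝓡 n).prod 𝓘(ℝ, F)) ∞ (fun t => TotalSpace.mk' F (c t) (u t)) J ∧
    ∀ t ∈ J, covDerivAlong nabla c u t = 0

/-- `c` is a smooth geodesic over the time domain `J`. -/
def IsGeodesicOn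
    (nabla : CovariantDerivative (𝓡 n) (EuclideanSpace ℝ (Fin n))
      (fun x : M => TangentSpace (𝓡 n) x))
    (c : ℝ → M) (J : Set ℝ) : Prop :=
  IsParallelAlong nabla c (velocity (n := n) c) J

/-- `nabla` is the Levi-Civita connection of the Riemannian metric `g`: it is torsion-free and
compatible with `g`. -/
def IsLeviCivita
    (g : ContMDiffRiemannianMetric (𝓡 n) ∞ (EuclideanSpace ℝ (Fin n))
      (fun x : M => TangentSpace (𝓡 n) x))
    (nabla : CovariantDerivative (𝓡 n) (EuclideanSpace ℝ (Fin n))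
      (fun x : M => TangentSpace (𝓡 n) x)) : Prop :=
  nabla.torsion = 0 ∧
    letI : RiemannianBundle (fun x : M => TangentSpace (𝓡 n) x) := ⟨g.toRiemannianMetric⟩
    haveI : IsContMDiffRiemannianBundle (𝓡 n) 1 (EuclideanSpace ℝ (Fin n))
      (fun x : M => TangentSpace (𝓡 n) x) :=
      IsContMDiffRiemannianBundle.of_le (n := ∞) (by norm_num)
    nabla.IsMetricCompatible

/-- The coordinate vector field `∂/∂xⁱ` of a chart `φ = (x¹, …, xⁿ)`. -/
def coordField (φ : OpenPartialHomeomorph M (EuclideanSpace ℝ (Fin n))) (i : Fin n) (x : M) :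
    TangentSpace (𝓡 n) x :=
  VectorField.mpullback (𝓡 n) 𝓘(ℝ, EuclideanSpace ℝ (Fin n)) φ
    (fun _ => (EuclideanSpace.single i 1 : EuclideanSpace ℝ (Fin n))) x

end Connections

/-! ### Normal geodesic coordinates, parallel frames, vielbeins -/

section NormalCoordinates

variable {n : ℕ} {M : Type*} [TopologicalSpace M] [ChartedSpace (EuclideanSpace ℝ (Fin n)) M]
  [IsManifold (𝓡 n) ∞ M]

/-- Normal geodesic coordinates around `p` on a geodesic neighbourhood `U_p`, together with the
local orthonormal frame of `TM` obtained by parallel transport along the radial geodesics.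

`chart` is the inverse of `(x¹, …, xⁿ) ↦ exp_p (∑ xⁱ eᵢ(p))`, from `U_p = chart.source` to the ball
of radius `radius`: for every `x`, the curve `t ↦ chart.symm (t x)` is the geodesic that starts at
`p` with velocity `∑ xⁱ eᵢ(p)`. -/
structure NormalCoordinates
    (g : ContMDiffRiemannianMetric (𝓡 n) ∞ (EuclideanSpace ℝ (Fin n))
      (fun x : M => TangentSpace (𝓡 n) x))
    (nabla : CovariantDerivative (𝓡 n) (EuclideanSpace ℝ (Fin n))
      (fun x : M => TangentSpace (𝓡 n) x))
    (p : M) where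
  /-- The coordinates `(x¹, …, xⁿ)` on `U_p`. -/
  chart : OpenPartialHomeomorph M (EuclideanSpace ℝ (Fin n))
  chart_mem : chart ∈ IsManifold.maximalAtlas (𝓡 n) ∞ M
  /-- The radius of the coordinate ball. -/
  radius : ℝ
  radius_pos : 0 < radius
  target_eq : chart.target = Metric.ball 0 radius
  base_mem : p ∈ chart.source
  chart_base : chart p = 0
  /-- The frame `e₁, …, eₙ` of `TM` over `U_p`. -/
  frame : Fin n → ∀ x : M, TangentSpace (𝓡 n) x
  isLocalFrame : IsLocalFrameOn (𝓡 n) (EuclideanSpace ℝ (Fin n)) ∞ frame chart.source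
  orthonormal_base : ∀ i j, g.inner p (frame i p) (frame j p) = if i = j then 1 else 0
  /-- The initial velocities: `∂/∂xⁱ = eᵢ` at `p`. -/
  coordField_base : ∀ i, coordField chart i p = frame i p
  geodesic : ∀ x, IsGeodesicOn nabla (fun t => chart.symm (t • x))
    {t : ℝ | t • x ∈ Metric.ball (0 : EuclideanSpace ℝ (Fin n)) radius}
  parallel : ∀ x i, IsParallelAlong nabla (fun t => chart.symm (t • x))
    (fun t => frame i (chart.symm (t • x)))
    {t : ℝ | t • x ∈ Metric.ball (0 : EuclideanSpace ℝ (Fin n)) radius}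

namespace NormalCoordinates

variable
  {g : ContMDiffRiemannianMetric (𝓡 n) ∞ (EuclideanSpace ℝ (Fin n))
    (fun x : M => TangentSpace (𝓡 n) x)}
  {nabla : CovariantDerivative (𝓡 n) (EuclideanSpace ℝ (Fin n))
    (fun x : M => TangentSpace (𝓡 n) x)}
  {p : M}

/-- The vielbein coefficient `aᵢˡ`, as a function of the normal coordinates:
`∂/∂xⁱ = ∑ₗ aᵢˡ eₗ`. -/
def vielbeinA (N : NormalCoordinates g nabla p) (i l : Fin n) :
    EuclideanSpace ℝ (Fin n) → ℝ :=
  fun y => N.isLocalFrame.coeff l (N.chart.symm y) (coordField N.chart i (N.chart.symm y))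

/-- The inverse vielbein coefficient `bₗʲ`, as a function of the normal coordinates:
`eₗ = ∑ⱼ bₗʲ ∂/∂xʲ`, that is `bₗʲ = dxʲ(eₗ)`. -/
def vielbeinB (N : NormalCoordinates g nabla p) (l j : Fin n) :
    EuclideanSpace ℝ (Fin n) → ℝ :=
  fun y => (show EuclideanSpace ℝ (Fin n) from
    mfderiv (𝓡 n) 𝓘(ℝ, EuclideanSpace ℝ (Fin n)) N.chart (N.chart.symm y)
      (N.frame l (N.chart.symm y))) j

end NormalCoordinates

/-- The symbols `D^β aᵢˡ` and `D^γ bₗʲ` for the jets of the vielbeins. -/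
inductive VielbeinJet (n : ℕ) : Type
  | a (β : Fin n → ℕ) (i l : Fin n) : VielbeinJet n
  | b (γ : Fin n → ℕ) (l j : Fin n) : VielbeinJet n

/-- The order of a jet: `|β|` for `D^β aᵢˡ` and `|γ|` for `D^γ bₗʲ`. -/
def VielbeinJet.order {n : ℕ} : VielbeinJet n → ℕ
  | .a β _ _ => multiOrder β
  | .b γ _ _ => multiOrder γ

/-- The function on the coordinate ball denoted by a jet symbol. -/
def VielbeinJet.toFun
    {g : ContMDiffRiemannianMetric (𝓡 n) ∞ (EuclideanSpace ℝ (Fin n))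
      (fun x : M => TangentSpace (𝓡 n) x)}
    {nabla : CovariantDerivative (𝓡 n) (EuclideanSpace ℝ (Fin n))
      (fun x : M => TangentSpace (𝓡 n) x)}
    {p : M} (N : NormalCoordinates g nabla p) :
    VielbeinJet n → EuclideanSpace ℝ (Fin n) → ℝ
  | .a β i l => multiDeriv β (N.vielbeinA i l)
  | .b γ l j => multiDeriv γ (N.vielbeinB l j)

/-- The function `f` of the normal coordinates is a geometric polynomial of Gilkey order `d` with
respect to `g`: on the coordinate ball it is a linear combination, with constant coefficients, of
products `∏ D^β(aᵢˡ) ∏ D^γ(bₗʲ)` of jets of vielbeins, each with total order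
`∑ |β| + ∑ |γ| = d`. -/
def IsGeometricPolynomial
    {g : ContMDiffRiemannianMetric (𝓡 n) ∞ (EuclideanSpace ℝ (Fin n))
      (fun x : M => TangentSpace (𝓡 n) x)}
    {nabla : CovariantDerivative (𝓡 n) (EuclideanSpace ℝ (Fin n))
      (fun x : M => TangentSpace (𝓡 n) x)}
    {p : M} (N : NormalCoordinates g nabla p) (d : ℕ)
    (f : EuclideanSpace ℝ (Fin n) → ℝ) : Prop :=
  ∃ q : MvPolynomial (VielbeinJet n) ℝ, q.IsWeightedHomogeneous VielbeinJet.order d ∧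
    ∀ y ∈ Metric.ball (0 : EuclideanSpace ℝ (Fin n)) N.radius,
      f y = q.eval fun J => J.toFun N y

end NormalCoordinates

/-! ### Differential operators -/

section DifferentialOperators

variable {n : ℕ} {M : Type*} [TopologicalSpace M] [ChartedSpace (EuclideanSpace ℝ (Fin n)) M]
  [IsManifold (𝓡 n) ∞ M]
  {F : Type*} [NormedAddCommGroup F] [NormedSpace ℝ F] [FiniteDimensional ℝ F]
  {E : M → Type*} [TopologicalSpace (TotalSpace F E)]
  [∀ x, AddCommGroup (E x)] [∀ x, Module ℝ (E x)] [∀ x, TopologicalSpace (E x)]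
  [∀ x, IsTopologicalAddGroup (E x)] [∀ x, ContinuousSMul ℝ (E x)]
  [FiberBundle F E] [VectorBundle ℝ F E] [ContMDiffVectorBundle ∞ F E (𝓡 n)]

/-- In the coordinates of `φ` and the local frame `s` of `E`, the operator `P` on smooth sections
of `E` reads `P (∑ⱼ αⱼ sⱼ) = ∑_{|γ| ≤ m} ∑_{i,j} (P_γ)_{ij} D^γ(αⱼ) sᵢ`, where the coefficient
`(P_γ)_{ij}` is the function `C γ i j` of the coordinates. -/
def ReadsAs
    (P : Cₛ^∞⟮𝓡 n; F, E⟯ →ₗ[ℝ] Cₛ^∞⟮𝓡 n; F, E⟯)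
    (φ : OpenPartialHomeomorph M (EuclideanSpace ℝ (Fin n)))
    {ι : Type*} [Fintype ι] {s : ι → ∀ x : M, E x}
    (hs : IsLocalFrameOn (𝓡 n) F ∞ s φ.source) (m : ℕ)
    (C : (Fin n → ℕ) → ι → ι → EuclideanSpace ℝ (Fin n) → ℝ) : Prop :=
  ∀ u : Cₛ^∞⟮𝓡 n; F, E⟯, ∀ y ∈ φ.target, ∀ i,
    hs.coeff i (φ.symm y) (P u (φ.symm y)) =
      ∑ γ ∈ multiIndices n m, ∑ j,
        C γ i j y * multiDeriv γ (fun z => hs.coeff j (φ.symm z) (u (φ.symm z))) y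

/-- `P` is a differential operator of order `m` (order at most `m` in the sense that derivatives of
order at most `m` occur) on the sections of `E`: in every smooth chart of `M` over whose domain `E`
has a smooth frame, `P = ∑_{|γ| ≤ m} P_γ D^γ` with smooth coefficients. -/
def IsDifferentialOperator (m : ℕ) (P : Cₛ^∞⟮𝓡 n; F, E⟯ →ₗ[ℝ] Cₛ^∞⟮𝓡 n; F, E⟯) : Prop :=
  ∀ φ ∈ IsManifold.maximalAtlas (𝓡 n) ∞ M,
    ∀ (s : Fin (Module.finrank ℝ F) → ∀ x : M, E x)
      (hs : IsLocalFrameOn (𝓡 n) F ∞ s φ.source),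
      ∃ C, (∀ γ i j, ContDiffOn ℝ ∞ (C γ i j) φ.target) ∧ ReadsAs P φ hs m C

variable
  {g : ContMDiffRiemannianMetric (𝓡 n) ∞ (EuclideanSpace ℝ (Fin n))
    (fun x : M => TangentSpace (𝓡 n) x)}
  {nabla : CovariantDerivative (𝓡 n) (EuclideanSpace ℝ (Fin n))
    (fun x : M => TangentSpace (𝓡 n) x)}
  {p : M}

/-- The local frame of `E` over `U_p` obtained from a basis of `E_p` by parallel transport along
the radial geodesics. -/
structure ParallelFrame (N : NormalCoordinates g nabla p)
    (nablaE : CovariantDerivative (𝓡 n) F E) where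
  /-- The sections `s₁, …, s_k`. -/
  sec : Fin (Module.finrank ℝ F) → ∀ x : M, E x
  isLocalFrame : IsLocalFrameOn (𝓡 n) F ∞ sec N.chart.source
  parallel : ∀ x i, IsParallelAlong nablaE (fun t => N.chart.symm (t • x))
    (fun t => sec i (N.chart.symm (t • x)))
    {t : ℝ | t • x ∈ Metric.ball (0 : EuclideanSpace ℝ (Fin n)) N.radius}

/-- `P` is a geometric differential operator of order `m` with respect to `g`: it is a differential
operator `∑_{|γ| ≤ m} P_γ D^γ` of order `m` whose coefficients, written in normal coordinates and
in the parallel frame of `E`, are geometric polynomials with Gilkey order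
`ord^Gi(P_γ) = m - |γ|` for all `|γ| ≤ m`. -/
def IsGeometricOperator (N : NormalCoordinates g nabla p)
    {nablaE : CovariantDerivative (𝓡 n) F E} (S : ParallelFrame N nablaE) (m : ℕ)
    (P : Cₛ^∞⟮𝓡 n; F, E⟯ →ₗ[ℝ] Cₛ^∞⟮𝓡 n; F, E⟯) : Prop :=
  IsDifferentialOperator m P ∧
    ∃ C, ReadsAs P N.chart S.isLocalFrame m C ∧
      ∀ γ ∈ multiIndices n m, ∀ i j, IsGeometricPolynomial N (m - multiOrder γ) (C γ i j)

end DifferentialOperators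

end

/-! ### Partial derivatives on an open set -/

section PartialDerivatives

variable {n : ℕ} {U : Set (EuclideanSpace ℝ (Fin n))} {f h : EuclideanSpace ℝ (Fin n) → ℝ}

/-! Give each term `f · D^γ` the total order `deg f + |γ|`, where `deg` is the Gilkey order; being
geometric of order `m` says that every term of the operator has total order `m`. The Leibniz rule
`∂ᵢ(f D^γ α) = (∂ᵢf) D^γ α + f D^(γ+eᵢ) α` raises total order by exactly one, provided `∂ᵢ` raises
Gilkey order by one. Multiplication by `f` raises it by `deg f`. So putting an operator of order
`m'` under a term `f D^γ` with `deg f = m - |γ|` yields order `m + m'`.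

The argument needs only a graded algebra of smooth functions on which `∂ᵢ` has degree one
(`IsGradedDifferentialAlgebra`), and it is carried out at that level in `IsGradedOperator.comp` and
`ReadsAs.comp`. It is applied twice: to all smooth functions in every chart, so that the composition
is a differential operator, and to geometric polynomials in the normal chart. The second case rests
on `IsGeometricPolynomial.partialDeriv`: differentiating a jet of a vielbein gives a jet of order
one higher, and the product rule extends this to polynomials in the jets. -/

lemma partialDeriv_eqOn (hU : IsOpen U) (hfh : Set.EqOn f h U) (i : Fin n) :
    Set.EqOn (partialDeriv i f) (partialDeriv i h) U := fun y hy => by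
  simp only [partialDeriv, (hfh.eventuallyEq_of_mem (hU.mem_nhds hy)).fderiv_eq]

lemma ContDiffOn.partialDeriv (hU : IsOpen U) (hf : ContDiffOn ℝ ∞ f U) (i : Fin n) :
    ContDiffOn ℝ ∞ (_root_.partialDeriv i f) U :=
  (hf.fderiv_of_isOpen hU (m := ∞) (by simp)).clm_apply contDiffOn_const

lemma ContDiffOn.differentiableAt_of_isOpen (hU : IsOpen U) (hf : ContDiffOn ℝ ∞ f U)
    {y : EuclideanSpace ℝ (Fin n)} (hy : y ∈ U) : DifferentiableAt ℝ f y :=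
  (hf.contDiffAt (hU.mem_nhds hy)).differentiableAt (by simp)

lemma partialDeriv_add_apply {y : EuclideanSpace ℝ (Fin n)} (hf : DifferentiableAt ℝ f y)
    (hh : DifferentiableAt ℝ h y) (i : Fin n) :
    partialDeriv i (fun z => f z + h z) y = partialDeriv i f y + partialDeriv i h y := by
  simp [partialDeriv, fderiv_fun_add hf hh]

lemma partialDeriv_mul_apply {y : EuclideanSpace ℝ (Fin n)} (hf : DifferentiableAt ℝ f y)
    (hh : DifferentiableAt ℝ h y) (i : Fin n) :
    partialDeriv i (fun z => f z * h z) y = partialDeriv i f y * h y + f y * partialDeriv i h y := by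
  simp [partialDeriv, fderiv_fun_mul hf hh]
  ring

lemma partialDeriv_const (i : Fin n) (c : ℝ) :
    partialDeriv i (fun _ : EuclideanSpace ℝ (Fin n) => c) = fun _ => 0 := by
  ext y
  simp [partialDeriv]

/-- Schwarz's theorem: both sides are values of the second Fréchet derivative on two basis vectors,
in opposite orders. -/
lemma partialDeriv_comm (hU : IsOpen U) (hf : ContDiffOn ℝ ∞ f U) (i j : Fin n) :
    Set.EqOn (partialDeriv i (partialDeriv j f)) (partialDeriv j (partialDeriv i f)) U := by
  intro y hy
  have hsymm : IsSymmSndFDerivAt ℝ f y :=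
    (hf.contDiffAt (hU.mem_nhds hy)).isSymmSndFDerivAt (by simpa using ENat.LEInfty.out)
  have hd : DifferentiableAt ℝ (fderiv ℝ f) y :=
    ((hf.fderiv_of_isOpen hU (m := ∞) (by simp)).contDiffAt (hU.mem_nhds hy)).differentiableAt
      (by simp)
  have key : ∀ v w : EuclideanSpace ℝ (Fin n),
      fderiv ℝ (fun x => fderiv ℝ f x v) y w = fderiv ℝ (fderiv ℝ f) y w v := fun v w => by
    rw [fderiv_clm_apply hd (differentiableAt_const v)]
    simp
  change fderiv ℝ (fun x => fderiv ℝ f x _) y _ = fderiv ℝ (fun x => fderiv ℝ f x _) y _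
  rw [key, key]
  exact hsymm _ _

/-- The iterated partial derivative `∂_{i₁}^{γ i₁} ⋯ ∂_{iᵣ}^{γ iᵣ}` along a list of directions. -/
noncomputable def listDeriv (γ : Fin n → ℕ) (l : List (Fin n)) (f : EuclideanSpace ℝ (Fin n) → ℝ) :
    EuclideanSpace ℝ (Fin n) → ℝ :=
  l.foldr (fun i h => (partialDeriv i)^[γ i] h) f

lemma iterate_partialDeriv_eqOn (hU : IsOpen U) (hfh : Set.EqOn f h U) (i : Fin n) (k : ℕ) :
    Set.EqOn ((partialDeriv i)^[k] f) ((partialDeriv i)^[k] h) U := by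
  induction k with
  | zero => exact hfh
  | succ k ih =>
    simp only [Function.iterate_succ_apply']
    exact partialDeriv_eqOn hU ih i

lemma ContDiffOn.iterate_partialDeriv (hU : IsOpen U) (hf : ContDiffOn ℝ ∞ f U) (i : Fin n)
    (k : ℕ) : ContDiffOn ℝ ∞ ((_root_.partialDeriv i)^[k] f) U := by
  induction k with
  | zero => exact hf
  | succ k ih =>
    simp only [Function.iterate_succ_apply']
    exact ih.partialDeriv hU i

lemma iterate_partialDeriv_comm (hU : IsOpen U) (hf : ContDiffOn ℝ ∞ f U) (i j : Fin n) (k : ℕ) :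
    Set.EqOn ((partialDeriv j)^[k] (partialDeriv i f)) (partialDeriv i ((partialDeriv j)^[k] f))
      U := by
  induction k with
  | zero => exact fun _ _ => rfl
  | succ k ih =>
    simp only [Function.iterate_succ_apply']
    exact (partialDeriv_eqOn hU ih j).trans
      (partialDeriv_comm hU (hf.iterate_partialDeriv hU j k) j i)

lemma listDeriv_eqOn (hU : IsOpen U) (hfh : Set.EqOn f h U) (γ : Fin n → ℕ) (l : List (Fin n)) :
    Set.EqOn (listDeriv γ l f) (listDeriv γ l h) U := by
  induction l with
  | nil => exact hfh
  | cons i l ih => exact iterate_partialDeriv_eqOn hU ih i (γ i)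

lemma ContDiffOn.listDeriv (hU : IsOpen U) (hf : ContDiffOn ℝ ∞ f U) (γ : Fin n → ℕ)
    (l : List (Fin n)) : ContDiffOn ℝ ∞ (_root_.listDeriv γ l f) U := by
  induction l with
  | nil => exact hf
  | cons i l ih => exact ih.iterate_partialDeriv hU i (γ i)

lemma listDeriv_add_single_of_notMem (γ : Fin n → ℕ) {i : Fin n} {l : List (Fin n)} (hi : i ∉ l) :
    listDeriv (γ + Pi.single i 1) l f = listDeriv γ l f := by
  induction l with
  | nil => rfl
  | cons j l ih =>
    rw [List.mem_cons, not_or] at hi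
    have hj : (γ + Pi.single i 1 : Fin n → ℕ) j = γ j := by simp [Ne.symm hi.1]
    change (partialDeriv j)^[_] (listDeriv _ l f) = (partialDeriv j)^[_] (listDeriv _ l f)
    rw [hj, ih hi.2]

/-- The extra `∂ᵢ` arises where `i` stands in the list and is commuted outwards past the other
directions. Without `Nodup`, each occurrence of `i` would contribute one more derivative. -/
lemma listDeriv_add_single_of_mem (hU : IsOpen U) (hf : ContDiffOn ℝ ∞ f U) (γ : Fin n → ℕ)
    {i : Fin n} {l : List (Fin n)} (hl : l.Nodup) (hi : i ∈ l) :
    Set.EqOn (listDeriv (γ + Pi.single i 1) l f) (partialDeriv i (listDeriv γ l f)) U := by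
  induction l with
  | nil => simp at hi
  | cons j l ih =>
    rw [List.nodup_cons] at hl
    change Set.EqOn ((partialDeriv j)^[_] (listDeriv _ l f))
      (partialDeriv i ((partialDeriv j)^[_] (listDeriv _ l f))) U
    by_cases hij : i = j
    · subst hij
      rw [listDeriv_add_single_of_notMem γ hl.1, Pi.add_apply, Pi.single_eq_same,
        Function.iterate_succ_apply']
      exact fun _ _ => rfl
    · have hj : (γ + Pi.single i 1 : Fin n → ℕ) j = γ j := by simp [Ne.symm hij]
      rw [hj]
      exact (iterate_partialDeriv_eqOn hU (ih hl.2 ((List.mem_cons.1 hi).resolve_left hij)) j _).trans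
        (iterate_partialDeriv_comm hU (hf.listDeriv hU γ l) i j _)

lemma multiDeriv_eqOn (hU : IsOpen U) (hfh : Set.EqOn f h U) (γ : Fin n → ℕ) :
    Set.EqOn (multiDeriv γ f) (multiDeriv γ h) U :=
  listDeriv_eqOn hU hfh γ _

lemma ContDiffOn.multiDeriv (hU : IsOpen U) (hf : ContDiffOn ℝ ∞ f U) (γ : Fin n → ℕ) :
    ContDiffOn ℝ ∞ (_root_.multiDeriv γ f) U :=
  hf.listDeriv hU γ _

/-- This is what keeps Leibniz expansions and derivatives of jets in the normal form `D^γ`, whose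
definition fixes an order of the directions. -/
lemma multiDeriv_add_single (hU : IsOpen U) (hf : ContDiffOn ℝ ∞ f U) (γ : Fin n → ℕ) (i : Fin n) :
    Set.EqOn (multiDeriv (γ + Pi.single i 1) f) (partialDeriv i (multiDeriv γ f)) U :=
  listDeriv_add_single_of_mem hU hf γ (List.nodup_finRange n) (List.mem_finRange i)

lemma multiOrder_add_single (γ : Fin n → ℕ) (i : Fin n) :
    multiOrder (γ + Pi.single i 1) = multiOrder γ + 1 := by
  simp [multiOrder, Finset.sum_add_distrib]

lemma mem_multiIndices {m : ℕ} {γ : Fin n → ℕ} : γ ∈ multiIndices n m ↔ multiOrder γ ≤ m := by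
  simp only [multiIndices, Finset.mem_filter, Fintype.mem_piFinset, Finset.mem_range,
    and_iff_right_iff_imp]
  exact fun h i => Nat.lt_succ_of_le
    ((Finset.single_le_sum (f := γ) (fun _ _ => Nat.zero_le _) (Finset.mem_univ i)).trans h)

end PartialDerivatives

/-! ### Differential operators with coefficients in a graded algebra of functions -/

section GradedOperators

variable {n : ℕ} {U : Set (EuclideanSpace ℝ (Fin n))}
  {G : ℕ → (EuclideanSpace ℝ (Fin n) → ℝ) → Prop}

/-- The predicates `G d` single out a graded algebra of functions which are smooth on `U`, in which
partial derivatives raise the degree by one. -/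
structure IsGradedDifferentialAlgebra (U : Set (EuclideanSpace ℝ (Fin n)))
    (G : ℕ → (EuclideanSpace ℝ (Fin n) → ℝ) → Prop) : Prop where
  contDiffOn : ∀ {d f}, G d f → ContDiffOn ℝ ∞ f U
  zero : ∀ d, G d fun _ => 0
  add : ∀ {d f h}, G d f → G d h → G d fun y => f y + h y
  mul : ∀ {d e f h}, G d f → G e h → G (d + e) fun y => f y * h y
  partialDeriv : ∀ {d f}, G d f → ∀ i, G (d + 1) (partialDeriv i f)

/-- A scalar operator on tuples of functions which on `U` is `∑_{|γ| ≤ m} ∑ₖ C γ k D^γ αₖ`, where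
`C γ k` has degree `m - |γ|`. -/
def IsGradedOperator (U : Set (EuclideanSpace ℝ (Fin n)))
    (G : ℕ → (EuclideanSpace ℝ (Fin n) → ℝ) → Prop) {ι : Type*} [Fintype ι] (m : ℕ)
    (T : (ι → EuclideanSpace ℝ (Fin n) → ℝ) → EuclideanSpace ℝ (Fin n) → ℝ) : Prop :=
  ∃ C : (Fin n → ℕ) → ι → EuclideanSpace ℝ (Fin n) → ℝ,
    (∀ γ ∈ multiIndices n m, ∀ k, G (m - multiOrder γ) (C γ k)) ∧
    ∀ α, (∀ k, ContDiffOn ℝ ∞ (α k) U) → ∀ y ∈ U,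
      T α y = ∑ γ ∈ multiIndices n m, ∑ k, C γ k y * multiDeriv γ (α k) y

namespace IsGradedOperator

variable {ι : Type*} [Fintype ι] {m : ℕ}
  {T T' : (ι → EuclideanSpace ℝ (Fin n) → ℝ) → EuclideanSpace ℝ (Fin n) → ℝ}

lemma congr (hT : IsGradedOperator U G m T)
    (h : ∀ α, (∀ k, ContDiffOn ℝ ∞ (α k) U) → ∀ y ∈ U, T' α y = T α y) :
    IsGradedOperator U G m T' := by
  obtain ⟨C, hC, hTC⟩ := hT
  exact ⟨C, hC, fun α hα y hy => (h α hα y hy).trans (hTC α hα y hy)⟩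

variable (hG : IsGradedDifferentialAlgebra U G)
include hG

lemma zero : IsGradedOperator U G m
    (fun (_ : ι → EuclideanSpace ℝ (Fin n) → ℝ) _ => (0 : ℝ)) :=
  ⟨fun _ _ _ => 0, fun _ _ _ => hG.zero _, fun α _ y _ => by simp⟩

lemma add (hT : IsGradedOperator U G m T) (hT' : IsGradedOperator U G m T') :
    IsGradedOperator U G m fun α y => T α y + T' α y := by
  obtain ⟨C, hC, hTC⟩ := hT
  obtain ⟨C', hC', hTC'⟩ := hT'
  refine ⟨fun γ k y => C γ k y + C' γ k y, fun γ hγ k => hG.add (hC γ hγ k) (hC' γ hγ k),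
    fun α hα y hy => ?_⟩
  simp only [hTC α hα y hy, hTC' α hα y hy, add_mul, Finset.sum_add_distrib]

lemma sum {κ : Type*} (t : Finset κ)
    {R : κ → (ι → EuclideanSpace ℝ (Fin n) → ℝ) → EuclideanSpace ℝ (Fin n) → ℝ}
    (hR : ∀ a ∈ t, IsGradedOperator U G m (R a)) :
    IsGradedOperator U G m fun α y => ∑ a ∈ t, R a α y := by
  classical
  induction t using Finset.induction_on with
  | empty => simpa using zero hG
  | insert a t ha ih =>
    simp only [Finset.sum_insert ha]
    exact (hR a (Finset.mem_insert_self a t)).add hG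
      (ih fun b hb => hR b (Finset.mem_insert_of_mem hb))

/-- The building block from which the other operators are assembled by `sum`. Stating the degree
condition as an addition forces `|γ| ≤ m` and keeps truncated subtraction out of the hypothesis. -/
lemma single {d : ℕ} {f : EuclideanSpace ℝ (Fin n) → ℝ} (hf : G d f) (γ : Fin n → ℕ) (k : ι)
    (hd : d + multiOrder γ = m) :
    IsGradedOperator U G m fun (α : ι → EuclideanSpace ℝ (Fin n) → ℝ) y =>
      f y * multiDeriv γ (α k) y := by
  classical
  refine ⟨fun δ j => if δ = γ ∧ j = k then f else fun _ => 0, fun δ _ j => ?_,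
    fun α _ y _ => ?_⟩
  · beta_reduce
    split_ifs with h
    · rwa [h.1, ← hd, Nat.add_sub_cancel]
    · exact hG.zero _
  · rw [Finset.sum_eq_single_of_mem γ (mem_multiIndices.2 (by omega)) fun δ _ hδ => by simp [hδ],
      Finset.sum_eq_single_of_mem k (Finset.mem_univ k) fun j _ hj => by simp [hj]]
    simp

lemma mul_left {d : ℕ} {f : EuclideanSpace ℝ (Fin n) → ℝ} (hf : G d f)
    (hT : IsGradedOperator U G m T) :
    IsGradedOperator U G (d + m) fun α y => f y * T α y := by
  obtain ⟨C, hC, hTC⟩ := hT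
  refine congr (T := fun α y => ∑ γ ∈ multiIndices n m, ∑ k,
      (f y * C γ k y) * multiDeriv γ (α k) y) ?_ fun α hα y hy => ?_
  · refine sum hG _ fun γ hγ => sum hG _ fun k _ => single hG (hG.mul hf (hC γ hγ k)) γ k ?_
    have := mem_multiIndices.1 hγ
    omega
  · simp only [hTC α hα y hy, Finset.mul_sum, mul_assoc]

/-- By the Leibniz rule each term splits in two: one gains a degree in its coefficient, the other a
derivative on `α`. -/
lemma partialDeriv (hU : IsOpen U) (hT : IsGradedOperator U G m T) (i : Fin n) :
    IsGradedOperator U G (m + 1) fun α => _root_.partialDeriv i (T α) := by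
  obtain ⟨C, hC, hTC⟩ := hT
  refine congr (T := fun α y => ∑ γ ∈ multiIndices n m, ∑ k,
      (_root_.partialDeriv i (C γ k) y * multiDeriv γ (α k) y +
        C γ k y * multiDeriv (γ + Pi.single i 1) (α k) y)) ?_ fun α hα y hy => ?_
  · refine sum hG _ fun γ hγ => sum hG _ fun k _ => ?_
    have := mem_multiIndices.1 hγ
    refine (single hG (hG.partialDeriv (hC γ hγ k) i) γ k ?_).add hG
      (single hG (hC γ hγ k) (γ + Pi.single i 1) k ?_)
    · omega
    · rw [multiOrder_add_single]
      omega
  · rw [partialDeriv_eqOn hU (hTC α hα) i hy]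
    have hd : ∀ γ ∈ multiIndices n m, ∀ k, DifferentiableAt ℝ (C γ k) y := fun γ hγ k =>
      (hG.contDiffOn (hC γ hγ k)).differentiableAt_of_isOpen hU hy
    have hd' : ∀ γ k, DifferentiableAt ℝ (multiDeriv γ (α k)) y := fun γ k =>
      ((hα k).multiDeriv hU γ).differentiableAt_of_isOpen hU hy
    have hmul : ∀ γ ∈ multiIndices n m, ∀ k,
        DifferentiableAt ℝ (fun z => C γ k z * multiDeriv γ (α k) z) y := fun γ hγ k =>
      (hd γ hγ k).fun_mul (hd' γ k)
    change fderiv ℝ _ y _ = _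
    rw [fderiv_fun_sum fun γ hγ => DifferentiableAt.fun_sum fun k _ => hmul γ hγ k,
      _root_.sum_apply]
    refine Finset.sum_congr rfl fun γ hγ => ?_
    rw [fderiv_fun_sum fun k _ => hmul γ hγ k, _root_.sum_apply]
    refine Finset.sum_congr rfl fun k _ => ?_
    rw [multiDeriv_add_single hU (hα k) γ i hy]
    exact partialDeriv_mul_apply (hd γ hγ k) (hd' γ k) i

lemma iterate_partialDeriv (hU : IsOpen U) (hT : IsGradedOperator U G m T) (i : Fin n) (r : ℕ) :
    IsGradedOperator U G (m + r) fun α => (_root_.partialDeriv i)^[r] (T α) := by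
  induction r with
  | zero => exact hT
  | succ r ih =>
    simp only [Function.iterate_succ_apply']
    exact ih.partialDeriv hG hU i

lemma multiDeriv (hU : IsOpen U) (hT : IsGradedOperator U G m T) (γ : Fin n → ℕ) :
    IsGradedOperator U G (m + multiOrder γ) fun α => _root_.multiDeriv γ (T α) := by
  -- The induction runs over arbitrary lists of directions, since `multiDeriv` is a fold over the
  -- fixed list `List.finRange n`.
  have key : ∀ l : List (Fin n),
      IsGradedOperator U G (m + (l.map γ).sum) fun α => listDeriv γ l (T α) := by
    intro l
    induction l with
    | nil => exact hT
    | cons i l ih =>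
      rw [List.map_cons, List.sum_cons, add_comm (γ i), ← add_assoc]
      exact ih.iterate_partialDeriv hG hU i (γ i)
  have hsum : ((List.finRange n).map γ).sum = multiOrder γ := by
    rw [multiOrder, ← List.ofFn_eq_map, List.sum_ofFn]
  rw [← hsum]
  exact key _

/-- Composition of graded operators: the orders add up. -/
lemma comp (hU : IsOpen U) {κ : Type*} [Fintype κ] {m' : ℕ}
    {C : (Fin n → ℕ) → κ → EuclideanSpace ℝ (Fin n) → ℝ}
    (hC : ∀ γ ∈ multiIndices n m', ∀ j, G (m' - multiOrder γ) (C γ j))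
    {R : κ → (ι → EuclideanSpace ℝ (Fin n) → ℝ) → EuclideanSpace ℝ (Fin n) → ℝ}
    (hR : ∀ j, IsGradedOperator U G m (R j)) :
    IsGradedOperator U G (m' + m) fun α y => ∑ γ ∈ multiIndices n m', ∑ j,
      C γ j y * _root_.multiDeriv γ (R j α) y := by
  refine sum hG _ fun γ hγ => sum hG _ fun j _ => ?_
  -- Without `|γ| ≤ m'` the truncated `m' - |γ|` and `|γ|` need not add up to `m'`.
  have hle := mem_multiIndices.1 hγ
  have := mul_left hG (hC γ hγ j) ((hR j).multiDeriv hG hU γ)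
  rwa [show m' - multiOrder γ + (m + multiOrder γ) = m' + m by omega] at this

end IsGradedOperator

end GradedOperators

/-! ### Coefficients of smooth sections -/

section FrameCoefficients

variable {H V M : Type*} [NormedAddCommGroup V] [NormedSpace ℝ V] [TopologicalSpace H]
  {I : ModelWithCorners ℝ V H} [TopologicalSpace M] [ChartedSpace H M]
  {F : Type*} [NormedAddCommGroup F] [NormedSpace ℝ F]
  {E : M → Type*} [TopologicalSpace (TotalSpace F E)]
  [∀ x, AddCommGroup (E x)] [∀ x, Module ℝ (E x)] [∀ x, TopologicalSpace (E x)]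
  [FiberBundle F E] [VectorBundle ℝ F E] {r : ℕ∞ω}
  {ι : Type*} [Fintype ι] {s : ι → ∀ x : M, E x} {u : Set M}

/-- The coefficients of a `C^r` section with respect to a `C^r` local frame are `C^r`. -/
lemma IsLocalFrameOn.contMDiffOn_coeff (hs : IsLocalFrameOn I F r s u) (hu : IsOpen u)
    {t : ∀ x : M, E x} (ht : ContMDiffOn I (I.prod 𝓘(ℝ, F)) r (fun x => TotalSpace.mk' F x (t x)) u)
    (i : ι) : ContMDiffOn I 𝓘(ℝ, ℝ) r (fun x => hs.coeff i x (t x)) u := by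
  classical
  intro x₀ hx₀
  refine ContMDiffAt.contMDiffWithinAt ?_
  set e := trivializationAt F E x₀
  have he : x₀ ∈ e.baseSet := FiberBundle.mem_baseSet_trivializationAt' x₀
  have htF : ContMDiffAt I 𝓘(ℝ, F) r (fun x => (e ⟨x, t x⟩).2) x₀ :=
    (contMDiffAt_section x₀).1 ((ht x₀ hx₀).contMDiffAt (hu.mem_nhds hx₀))
  have hsF : ∀ j, ContMDiffAt I 𝓘(ℝ, F) r (fun x => (e ⟨x, s j x⟩).2) x₀ := fun j =>
    (contMDiffAt_section x₀).1 (hs.contMDiffAt hu hx₀ j)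
  let L : (ι → F) →L[ℝ] ((ι → ℝ) →L[ℝ] F) :=
    ∑ j, (ContinuousLinearMap.smulRightL ℝ (ι → ℝ) F (ContinuousLinearMap.proj j)).comp
      (ContinuousLinearMap.proj j)
  have hL : ∀ v c, L v c = ∑ j, c j • v j := fun v c => by simp [L]
  -- In the trivialization, `A x` sends coefficients `c` to `∑ cⱼ sⱼ(x)`. The coefficients of `t`
  -- are `(A x)⁻¹ (t x)`, so they are as regular as the frame and the section because operator
  -- inversion is smooth at invertible operators.
  let A : M → ((ι → ℝ) →L[ℝ] F) := fun x => L fun j => (e ⟨x, s j x⟩).2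
  have hA : ContMDiffAt I 𝓘(ℝ, (ι → ℝ) →L[ℝ] F) r A x₀ :=
    L.contDiff.contDiffAt.comp_contMDiffAt (contMDiffAt_pi_space.2 hsF)
  have hAeq : ∀ x (hx : x ∈ u) (hxe : x ∈ e.baseSet), A x =
      (((hs.toBasisAt hx).equivFun.symm.trans
        (e.linearEquivAt ℝ x hxe)).toContinuousLinearEquiv : (ι → ℝ) →L[ℝ] F) := by
    intro x hx hxe
    ext c
    change L _ c = e.linearEquivAt ℝ x hxe ((hs.toBasisAt hx).equivFun.symm c)
    rw [hL, Module.Basis.equivFun_symm_apply, map_sum]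
    simp_rw [map_smul, hs.toBasisAt_coe hx]
    rfl
  have hinv : ContMDiffAt I 𝓘(ℝ, F →L[ℝ] (ι → ℝ)) r (fun x => (A x).inverse) x₀ := by
    refine ContDiffAt.comp_contMDiffAt (g := ContinuousLinearMap.inverse) ?_ hA
    rw [hAeq x₀ hx₀ he]
    exact contDiffAt_map_inverse _
  have hmain := contMDiffAt_pi_space.1 (hinv.clm_apply htF) i
  refine hmain.congr_of_eventuallyEq ?_
  filter_upwards [hu.mem_nhds hx₀, e.open_baseSet.mem_nhds he] with x hx hxe
  rw [hAeq x hx hxe, ContinuousLinearMap.inverse_equiv, hs.coeff_apply_of_mem hx]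
  change _ = (hs.toBasisAt hx).equivFun
    ((e.linearEquivAt ℝ x hxe).symm (e.linearEquivAt ℝ x hxe (t x))) i
  rw [LinearEquiv.symm_apply_apply]
  rfl

end FrameCoefficients

/-! ### Frame coefficients and coordinate vector fields read in a chart -/

section Charts

variable {n : ℕ} {M : Type*} [TopologicalSpace M] [ChartedSpace (EuclideanSpace ℝ (Fin n)) M]
  {φ : OpenPartialHomeomorph M (EuclideanSpace ℝ (Fin n))}

lemma contDiffOn_comp_chart_symm {W : Type*} [NormedAddCommGroup W] [NormedSpace ℝ W]
    (hφ : φ ∈ IsManifold.maximalAtlas (𝓡 n) ∞ M) {f : M → W}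
    (hf : ContMDiffOn (𝓡 n) 𝓘(ℝ, W) ∞ f φ.source) :
    ContDiffOn ℝ ∞ (fun y => f (φ.symm y)) φ.target :=
  contMDiffOn_iff_contDiffOn.1
    (hf.comp (contMDiffOn_symm_of_mem_maximalAtlas hφ) fun _ hy => φ.map_target hy)

lemma contDiffOn_coeff_comp_chart_symm
    {F : Type*} [NormedAddCommGroup F] [NormedSpace ℝ F]
    {E : M → Type*} [TopologicalSpace (TotalSpace F E)]
    [∀ x, AddCommGroup (E x)] [∀ x, Module ℝ (E x)] [∀ x, TopologicalSpace (E x)]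
    [FiberBundle F E] [VectorBundle ℝ F E]
    {ι : Type*} [Fintype ι] {s : ι → ∀ x : M, E x}
    (hφ : φ ∈ IsManifold.maximalAtlas (𝓡 n) ∞ M) (hs : IsLocalFrameOn (𝓡 n) F ∞ s φ.source)
    (u : Cₛ^∞⟮𝓡 n; F, E⟯) (j : ι) :
    ContDiffOn ℝ ∞ (fun z => hs.coeff j (φ.symm z) (u (φ.symm z))) φ.target :=
  contDiffOn_comp_chart_symm hφ (hs.contMDiffOn_coeff φ.open_source u.contMDiff.contMDiffOn j)

variable [IsManifold (𝓡 n) ∞ M]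

/-- A chart of the maximal atlas has invertible derivative on its source, so pulling back a constant
field along it preserves smoothness. -/
lemma contMDiffOn_coordField (hφ : φ ∈ IsManifold.maximalAtlas (𝓡 n) ∞ M) (i : Fin n) :
    ContMDiffOn (𝓡 n) (𝓡 n).tangent ∞
      (fun x => (TotalSpace.mk' (EuclideanSpace ℝ (Fin n)) x (coordField φ i x) :
        TangentBundle (𝓡 n) M)) φ.source := by
  intro x hx
  have hd : φ.MDifferentiable (𝓡 n) 𝓘(ℝ, EuclideanSpace ℝ (Fin n)) :=
    ⟨(contMDiffOn_of_mem_maximalAtlas hφ).mdifferentiableOn (by simp),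
      (contMDiffOn_symm_of_mem_maximalAtlas hφ).mdifferentiableOn (by simp)⟩
  refine ContMDiffAt.contMDiffWithinAt ?_
  refine ContMDiffAt.mpullback_vectorField_preimage (n := ∞) ?_
    (contMDiffAt_of_mem_maximalAtlas hφ hx) ⟨hd.mfderiv hx, rfl⟩ (by simp)
  exact contMDiffAt_vectorSpace_iff_contDiffAt.2 contDiffAt_const

/-- The function is the fibre component of the tangent map of `φ` composed with `X`, and tangent
maps of smooth maps are smooth. -/
lemma contMDiffOn_mfderiv_chart_apply (hφ : φ ∈ IsManifold.maximalAtlas (𝓡 n) ∞ M)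
    {X : ∀ x : M, TangentSpace (𝓡 n) x}
    (hX : ContMDiffOn (𝓡 n) (𝓡 n).tangent ∞
      (fun x => (TotalSpace.mk' (EuclideanSpace ℝ (Fin n)) x (X x) : TangentBundle (𝓡 n) M))
      φ.source) :
    ContMDiffOn (𝓡 n) 𝓘(ℝ, EuclideanSpace ℝ (Fin n)) ∞
      (fun x => (mfderiv (𝓡 n) 𝓘(ℝ, EuclideanSpace ℝ (Fin n)) φ x (X x) :
        EuclideanSpace ℝ (Fin n))) φ.source := by
  have h₁ := (contMDiffOn_of_mem_maximalAtlas hφ).contMDiffOn_tangentMapWithin (m := ∞)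
    (by simp) φ.open_source.uniqueMDiffOn
  have h₂ := (contMDiff_snd_tangentBundle_modelSpace (EuclideanSpace ℝ (Fin n))
    (𝓡 n) (n := ∞)).comp_contMDiffOn (h₁.comp hX fun x hx => hx)
  refine h₂.congr fun x hx => ?_
  change _ = mfderivWithin (𝓡 n) 𝓘(ℝ, EuclideanSpace ℝ (Fin n)) φ φ.source x (X x)
  rw [mfderivWithin_of_isOpen φ.open_source hx]

end Charts

/-! ### Geometric polynomials -/

section GeometricPolynomials

variable {n : ℕ} {M : Type*} [TopologicalSpace M] [ChartedSpace (EuclideanSpace ℝ (Fin n)) M]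
  [IsManifold (𝓡 n) ∞ M]
  {g : ContMDiffRiemannianMetric (𝓡 n) ∞ (EuclideanSpace ℝ (Fin n))
    (fun x : M => TangentSpace (𝓡 n) x)}
  {nabla : CovariantDerivative (𝓡 n) (EuclideanSpace ℝ (Fin n))
    (fun x : M => TangentSpace (𝓡 n) x)}
  {p : M} (N : NormalCoordinates g nabla p)

namespace NormalCoordinates

lemma contDiffOn_vielbeinA (i l : Fin n) :
    ContDiffOn ℝ ∞ (N.vielbeinA i l) (Metric.ball 0 N.radius) := by
  rw [← N.target_eq]
  exact contDiffOn_comp_chart_symm N.chart_mem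
    (N.isLocalFrame.contMDiffOn_coeff N.chart.open_source (contMDiffOn_coordField N.chart_mem i) l)

lemma contDiffOn_vielbeinB (l j : Fin n) :
    ContDiffOn ℝ ∞ (N.vielbeinB l j) (Metric.ball 0 N.radius) := by
  rw [← N.target_eq]
  exact (EuclideanSpace.proj (𝕜 := ℝ) j).contDiff.comp_contDiffOn
    (contDiffOn_comp_chart_symm N.chart_mem
      (contMDiffOn_mfderiv_chart_apply N.chart_mem (N.isLocalFrame.contMDiffOn l)))

end NormalCoordinates

lemma VielbeinJet.contDiffOn_toFun (J : VielbeinJet n) :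
    ContDiffOn ℝ ∞ (J.toFun N) (Metric.ball 0 N.radius) := by
  cases J with
  | a β i l => exact (N.contDiffOn_vielbeinA i l).multiDeriv Metric.isOpen_ball β
  | b γ l j => exact (N.contDiffOn_vielbeinB l j).multiDeriv Metric.isOpen_ball γ

namespace IsGeometricPolynomial

variable {N} {d e : ℕ} {f h : EuclideanSpace ℝ (Fin n) → ℝ}

lemma congr (hf : IsGeometricPolynomial N d f) (hhf : Set.EqOn h f (Metric.ball 0 N.radius)) :
    IsGeometricPolynomial N d h := by
  obtain ⟨q, hq, hfq⟩ := hf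
  exact ⟨q, hq, fun y hy => (hhf hy).trans (hfq y hy)⟩

variable (N) in
lemma zero (d : ℕ) : IsGeometricPolynomial N d fun _ => 0 :=
  ⟨0, MvPolynomial.isWeightedHomogeneous_zero ℝ _ d, fun _ _ => by simp⟩

variable (N) in
lemma toFun (J : VielbeinJet n) : IsGeometricPolynomial N J.order (J.toFun N) :=
  ⟨MvPolynomial.X J, MvPolynomial.isWeightedHomogeneous_X ℝ _ J, fun _ _ => by simp⟩

lemma add (hf : IsGeometricPolynomial N d f) (hh : IsGeometricPolynomial N d h) :
    IsGeometricPolynomial N d fun y => f y + h y := by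
  obtain ⟨q, hq, hfq⟩ := hf
  obtain ⟨q', hq', hhq⟩ := hh
  exact ⟨q + q', hq.add hq', fun y hy => by simp [hfq y hy, hhq y hy]⟩

lemma mul (hf : IsGeometricPolynomial N d f) (hh : IsGeometricPolynomial N e h) :
    IsGeometricPolynomial N (d + e) fun y => f y * h y := by
  obtain ⟨q, hq, hfq⟩ := hf
  obtain ⟨q', hq', hhq⟩ := hh
  exact ⟨q * q', hq.mul hq', fun y hy => by simp [hfq y hy, hhq y hy]⟩

lemma contDiffOn (hf : IsGeometricPolynomial N d f) :
    ContDiffOn ℝ ∞ f (Metric.ball 0 N.radius) := by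
  obtain ⟨q, -, hfq⟩ := hf
  refine ContDiffOn.congr ?_ hfq
  simp only [MvPolynomial.eval_eq]
  exact ContDiffOn.sum fun s _ => contDiffOn_const.mul
    (contDiffOn_prod fun J _ => (J.contDiffOn_toFun N).pow _)

/-- The derivative is again a jet symbol, with multi-index increased by `eᵢ`. This is why `∂ᵢ` has
degree one on geometric polynomials. -/
lemma partialDeriv_toFun (J : VielbeinJet n) (i : Fin n) :
    IsGeometricPolynomial N (J.order + 1) (_root_.partialDeriv i (J.toFun N)) := by
  cases J with
  | a β k l =>
    have := toFun N (.a (β + Pi.single i 1) k l)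
    rw [VielbeinJet.order, multiOrder_add_single] at this
    exact this.congr fun y hy =>
      (multiDeriv_add_single Metric.isOpen_ball (N.contDiffOn_vielbeinA k l) β i hy).symm
  | b γ l j =>
    have := toFun N (.b (γ + Pi.single i 1) l j)
    rw [VielbeinJet.order, multiOrder_add_single] at this
    exact this.congr fun y hy =>
      (multiDeriv_add_single Metric.isOpen_ball (N.contDiffOn_vielbeinB l j) γ i hy).symm

lemma partialDeriv_add (hf : IsGeometricPolynomial N d f) (hh : IsGeometricPolynomial N d h)
    {i : Fin n} (hf' : IsGeometricPolynomial N e (_root_.partialDeriv i f))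
    (hh' : IsGeometricPolynomial N e (_root_.partialDeriv i h)) :
    IsGeometricPolynomial N e (_root_.partialDeriv i fun y => f y + h y) :=
  (hf'.add hh').congr fun _ hy => partialDeriv_add_apply
    (hf.contDiffOn.differentiableAt_of_isOpen Metric.isOpen_ball hy)
    (hh.contDiffOn.differentiableAt_of_isOpen Metric.isOpen_ball hy) i

lemma partialDeriv_mul (hf : IsGeometricPolynomial N d f) (hh : IsGeometricPolynomial N e h)
    {i : Fin n} (hf' : IsGeometricPolynomial N (d + 1) (_root_.partialDeriv i f))
    (hh' : IsGeometricPolynomial N (e + 1) (_root_.partialDeriv i h)) :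
    IsGeometricPolynomial N (d + e + 1) (_root_.partialDeriv i fun y => f y * h y) := by
  have h₁ := hf'.mul hh
  rw [show d + 1 + e = d + e + 1 by omega] at h₁
  exact (h₁.add (hf.mul hh')).congr fun _ hy => partialDeriv_mul_apply
    (hf.contDiffOn.differentiableAt_of_isOpen Metric.isOpen_ball hy)
    (hh.contDiffOn.differentiableAt_of_isOpen Metric.isOpen_ball hy) i

/-- The zero function has every Gilkey order, so `d` is free. -/
lemma partialDeriv_const (d : ℕ) (i : Fin n) (c : ℝ) :
    IsGeometricPolynomial N d (_root_.partialDeriv i fun _ => c) := by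
  rw [_root_.partialDeriv_const]
  exact zero N d

lemma monomial (s : VielbeinJet n →₀ ℕ) (c : ℝ) :
    IsGeometricPolynomial N (Finsupp.weight VielbeinJet.order s)
      fun y => (MvPolynomial.monomial s c).eval fun J => J.toFun N y :=
  ⟨_, MvPolynomial.isWeightedHomogeneous_monomial _ s c rfl, fun _ _ => rfl⟩

lemma partialDeriv_monomial (s : VielbeinJet n →₀ ℕ) (c : ℝ) (i : Fin n) :
    IsGeometricPolynomial N (Finsupp.weight VielbeinJet.order s + 1)
      (_root_.partialDeriv i fun y => (MvPolynomial.monomial s c).eval fun J => J.toFun N y) := by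
  induction s using Finsupp.induction_linear generalizing c with
  | zero =>
    simp only [← MvPolynomial.C_apply, MvPolynomial.eval_C]
    exact partialDeriv_const _ i c
  | add s t hs ht =>
    -- The scalar is carried by one factor and the other gets coefficient `1`; hence the induction
    -- is over all `c`.
    have := partialDeriv_mul (monomial s c) (monomial t 1) (hs c) (ht 1)
    simpa only [map_add, ← map_mul, MvPolynomial.monomial_mul, mul_one] using this
  | single J r =>
    induction r generalizing c with
    | zero =>
      simp only [Finsupp.single_zero, ← MvPolynomial.C_apply, MvPolynomial.eval_C]
      exact partialDeriv_const _ i c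
    | succ r ih =>
      have := partialDeriv_mul (monomial (Finsupp.single J r) c) (toFun N J) (ih c)
        (partialDeriv_toFun J i)
      rw [Finsupp.single_add, map_add, Finsupp.weight_single VielbeinJet.order J 1, one_smul]
      simpa only [MvPolynomial.monomial_add_single, pow_one, map_mul, MvPolynomial.eval_X] using this

/-- The partial derivatives of a geometric polynomial of Gilkey order `d` are geometric polynomials
of Gilkey order `d + 1`. -/
lemma partialDeriv (hf : IsGeometricPolynomial N d f) (i : Fin n) :
    IsGeometricPolynomial N (d + 1) (_root_.partialDeriv i f) := by
  obtain ⟨q, hq, hfq⟩ := hf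
  refine congr ?_ (partialDeriv_eqOn Metric.isOpen_ball hfq i)
  rw [q.as_sum]
  -- Both claims are carried along because the sum rule needs the partial sums to be differentiable,
  -- which follows from their being geometric polynomials. Staying within the support makes every
  -- monomial have weight `d`.
  have key : ∀ t : Finset (VielbeinJet n →₀ ℕ), t ⊆ q.support →
      IsGeometricPolynomial N d (fun y =>
        (∑ s ∈ t, MvPolynomial.monomial s (q.coeff s)).eval fun J => J.toFun N y) ∧
      IsGeometricPolynomial N (d + 1) (_root_.partialDeriv i fun y =>
        (∑ s ∈ t, MvPolynomial.monomial s (q.coeff s)).eval fun J => J.toFun N y) := by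
    classical
    intro t
    induction t using Finset.induction_on with
    | empty => exact fun _ => by simpa using ⟨zero N d, partialDeriv_const (d + 1) i 0⟩
    | insert s t hst ih =>
      intro hsub
      obtain ⟨hs, ht⟩ := Finset.insert_subset_iff.1 hsub
      obtain ⟨h₁, h₂⟩ := ih ht
      have hd : Finsupp.weight VielbeinJet.order s = d := hq (MvPolynomial.mem_support_iff.1 hs)
      have h₃ := monomial (N := N) s (q.coeff s)
      have h₄ := partialDeriv_monomial (N := N) s (q.coeff s) i
      rw [hd] at h₃ h₄
      simp only [Finset.sum_insert hst, map_add]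
      exact ⟨h₃.add h₁, partialDeriv_add h₃ h₁ h₄ h₂⟩
  exact (key _ subset_rfl).2

variable (N) in
lemma isGradedDifferentialAlgebra :
    IsGradedDifferentialAlgebra (Metric.ball 0 N.radius) (IsGeometricPolynomial N) where
  contDiffOn := contDiffOn
  zero := zero N
  add := add
  mul := mul
  partialDeriv := partialDeriv

end IsGeometricPolynomial

end GeometricPolynomials

/-! ### Composition of differential operators -/

/-- With every degree equal to the whole space of smooth functions, the graded composition result
becomes the ordinary one for differential operators. -/
lemma isGradedDifferentialAlgebra_contDiffOn {n : ℕ} {U : Set (EuclideanSpace ℝ (Fin n))}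
    (hU : IsOpen U) : IsGradedDifferentialAlgebra U fun _ f => ContDiffOn ℝ ∞ f U where
  contDiffOn := id
  zero _ := contDiffOn_const
  add := ContDiffOn.add
  mul := ContDiffOn.mul
  partialDeriv hf i := hf.partialDeriv hU i

section Composition

variable {n : ℕ} {M : Type*} [TopologicalSpace M] [ChartedSpace (EuclideanSpace ℝ (Fin n)) M]
  {F : Type*} [NormedAddCommGroup F] [NormedSpace ℝ F]
  {E : M → Type*} [TopologicalSpace (TotalSpace F E)]
  [∀ x, AddCommGroup (E x)] [∀ x, Module ℝ (E x)] [∀ x, TopologicalSpace (E x)]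
  [FiberBundle F E] [VectorBundle ℝ F E]

/-- If the coefficients of `P` and `Q` lie in a graded differential algebra of functions, with
degree complementary to the order of differentiation, then so do those of `P ∘ Q`. -/
lemma ReadsAs.comp {P Q : Cₛ^∞⟮𝓡 n; F, E⟯ →ₗ[ℝ] Cₛ^∞⟮𝓡 n; F, E⟯}
    {φ : OpenPartialHomeomorph M (EuclideanSpace ℝ (Fin n))}
    (hφ : φ ∈ IsManifold.maximalAtlas (𝓡 n) ∞ M)
    {ι : Type*} [Fintype ι] {s : ι → ∀ x : M, E x}
    {hs : IsLocalFrameOn (𝓡 n) F ∞ s φ.source} {m m' : ℕ}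
    {C C' : (Fin n → ℕ) → ι → ι → EuclideanSpace ℝ (Fin n) → ℝ}
    (hP : ReadsAs P φ hs m C) (hQ : ReadsAs Q φ hs m' C')
    {G : ℕ → (EuclideanSpace ℝ (Fin n) → ℝ) → Prop}
    (hG : IsGradedDifferentialAlgebra φ.target G)
    (hC : ∀ γ ∈ multiIndices n m, ∀ i j, G (m - multiOrder γ) (C γ i j))
    (hC' : ∀ γ ∈ multiIndices n m', ∀ i j, G (m' - multiOrder γ) (C' γ i j)) :
    ∃ D, ReadsAs (P ∘ₗ Q) φ hs (m + m') D ∧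
      ∀ γ ∈ multiIndices n (m + m'), ∀ i j, G (m + m' - multiOrder γ) (D γ i j) := by
  have hR : ∀ j, IsGradedOperator φ.target G m' fun (α : ι → EuclideanSpace ℝ (Fin n) → ℝ) y =>
      ∑ δ ∈ multiIndices n m', ∑ k, C' δ j k y * multiDeriv δ (α k) y := fun j =>
    ⟨fun δ => C' δ j, fun δ hδ k => hC' δ hδ j k, fun _ _ _ _ => rfl⟩
  -- For each output component `i`, the row `C · i ·` of `P` is composed with the operators that
  -- give the components of `Q`.
  choose D hD hDeq using fun i =>
    IsGradedOperator.comp hG φ.open_target (fun γ hγ j => hC γ hγ i j) hR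
  refine ⟨fun γ i j => D i γ j, fun u y hy i => ?_, fun γ hγ i j => hD i γ hγ j⟩
  rw [← hDeq i (fun k z => hs.coeff k (φ.symm z) (u (φ.symm z)))
    (contDiffOn_coeff_comp_chart_symm hφ hs u) y hy, LinearMap.comp_apply, hP (Q u) y hy i]
  refine Finset.sum_congr rfl fun γ _ => Finset.sum_congr rfl fun j _ => ?_
  -- The formula for `Q u` holds only on the open chart target, which is enough to replace it under
  -- `D^γ` there.
  rw [multiDeriv_eqOn φ.open_target (fun z hz => hQ u z hz j) γ hy]

lemma IsDifferentialOperator.comp {P Q : Cₛ^∞⟮𝓡 n; F, E⟯ →ₗ[ℝ] Cₛ^∞⟮𝓡 n; F, E⟯} {m m' : ℕ}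
    (hP : IsDifferentialOperator m P) (hQ : IsDifferentialOperator m' Q) :
    IsDifferentialOperator (m + m') (P ∘ₗ Q) := by
  classical
  intro φ hφ s hs
  obtain ⟨C, hC, hPC⟩ := hP φ hφ s hs
  obtain ⟨C', hC', hQC⟩ := hQ φ hφ s hs
  obtain ⟨D, hD, hDsmooth⟩ := hPC.comp hφ hQC (isGradedDifferentialAlgebra_contDiffOn φ.open_target)
    (fun γ _ i j => hC γ i j) (fun γ _ i j => hC' γ i j)
  -- `IsDifferentialOperator` asks for smooth coefficients at every `γ`, but `D` is controlled only
  -- for `|γ| ≤ m + m'`. The remaining coefficients never enter the sum and are set to zero.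
  refine ⟨fun γ i j => if γ ∈ multiIndices n (m + m') then D γ i j else fun _ => 0,
    fun γ i j => ?_, fun u y hy i => ?_⟩
  · beta_reduce
    split_ifs with hγ
    · exact hDsmooth γ hγ i j
    · exact contDiffOn_const
  · rw [hD u y hy i]
    exact Finset.sum_congr rfl fun γ hγ => by simp only [if_pos hγ]

end Composition

theorem proposition4p8 {n : ℕ} {M : Type*} [TopologicalSpace M] [T2Space M]
    [SecondCountableTopology M] [ChartedSpace (EuclideanSpace ℝ (Fin n)) M]
    [IsManifold (𝓡 n) ∞ M]
    (g : ContMDiffRiemannianMetric (𝓡 n) ∞ (EuclideanSpace ℝ (Fin n))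
      (fun x : M => TangentSpace (𝓡 n) x))
    (nabla : CovariantDerivative (𝓡 n) (EuclideanSpace ℝ (Fin n))
      (fun x : M => TangentSpace (𝓡 n) x))
    (hnabla : IsLeviCivita g nabla)
    {F : Type*} [NormedAddCommGroup F] [NormedSpace ℝ F] [FiniteDimensional ℝ F]
    {E : M → Type*} [TopologicalSpace (TotalSpace F E)]
    [∀ x, AddCommGroup (E x)] [∀ x, Module ℝ (E x)] [∀ x, TopologicalSpace (E x)]
    [∀ x, IsTopologicalAddGroup (E x)] [∀ x, ContinuousSMul ℝ (E x)]
    [FiberBundle F E] [VectorBundle ℝ F E] [ContMDiffVectorBundle ∞ F E (𝓡 n)]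
    (nablaE : CovariantDerivative (𝓡 n) F E)
    [CovariantDerivative.ContMDiffCovariantDerivative nablaE ∞]
    (p : M) (N : NormalCoordinates g nabla p) (S : ParallelFrame N nablaE)
    (m m' : ℕ) (P Q : Cₛ^∞⟮𝓡 n; F, E⟯ →ₗ[ℝ] Cₛ^∞⟮𝓡 n; F, E⟯)
    (hP : IsGeometricOperator N S m P) (hQ : IsGeometricOperator N S m' Q) :
    IsGeometricOperator N S (m + m') (P ∘ₗ Q) := by
  refine ⟨hP.1.comp hQ.1, ?_⟩
  obtain ⟨-, C, hPC, hC⟩ := hP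
  obtain ⟨-, C', hQC, hC'⟩ := hQ
  have hG := IsGeometricPolynomial.isGradedDifferentialAlgebra N
  -- Geometric polynomials live on the coordinate ball, which is the target of the normal chart.
  rw [← N.target_eq] at hG
  exact hPC.comp N.chart_mem hQC hG hC hC'
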